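/- **Notation.** For $\gamma>-1$ and $1\le p\le\infty$ let $L^p_{w(\gamma)}$ be the space of measurable (real- or complex-valued) functions $f$ on $(0,\infty)$ with finite norm $$\|f\|_{L^p_{w(\gamma)}}=\Big(\int_0^\infty |f(x)e^{-x/2}|^p\,x^\gamma\,dx\Big)^{1/p}\quad(1\le p<\infty),\qquad \|f\|_{L^\infty_{w(\gamma)}}=\operatorname*{ess\,sup}_{x>0}|f(x)e^{-x/2}|.$$ Let $L_n^\gamma(x)=\sum_{i=0}^n\binom{n+\gamma}{n-i}\frac{(-x)^i}{i!}$ be the Laguerre polynomials of order $\gamma$, let $R_n^\gamma(x)=L_n^\gamma(x)/L_n^\gamma(0)$, and define the Fourier–Laguerre coefficients of order $\gamma$ of a function $f$ by $$\hat f_\gamma(n)=\int_0^\infty f(x)R_n^\gamma(x)\,x^\gamma e^{-x}\,dx,\qquad n=0,1,2,\dots,$$ if the integrals exist. One writes $f(x)\sim\Gamma(\gamma+1)^{-1}\sum_{k=0}^\infty c_kL_k^\gamma(x)$ if $\hat f_\gamma(k)$ exists and equals $c_k$ for every $k\ge0$. **Theorem.** Let $1\le p\le\infty$, let $\alpha>-1$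 if $p<\infty$ and $\alpha\ge0$ if $p=\infty$, and let $-1<\beta<\alpha$. There is a constant $C$, depending only on $p,\alpha,\beta$, such that for every $f\in L^p_{w(\alpha)}$ all coefficients $\hat f_\alpha(k)$ exist (as absolutely convergent integrals) and there is a function $g\in L^p_{w(\beta)}$ with $$g(x)\sim\frac1{\Gamma(\beta+1)}\sum_{k=0}^\infty\hat f_\alpha(k)\,L_k^\beta(x),\qquad \|g\|_{L^p_{w(\beta)}}\le C\,\|f\|_{L^p_{w(\alpha)}},$$ where the integrals $\hat g_\beta(k)$ converge absolutely. -/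

import Mathlib

open MeasureTheory Set
open scoped NNReal ENNReal

noncomputable section

/-- The Laguerre polynomial `L_n^α`, for `α > -1`:
`L_n^α(x) = ∑_{i=0}^n binom(n+α, n-i) (-x)^i / i!`, where the binomial coefficient is
`Γ(n+α+1) / (Γ(n-i+1) Γ(α+i+1))`. -/
def laguerreL (α : ℝ) (n : ℕ) (x : ℝ) : ℝ :=
  ∑ i ∈ Finset.range (n + 1),
    Real.Gamma (n + α + 1) / ((Nat.factorial (n - i) : ℝ) * Real.Gamma (α + i + 1)) *
      ((-x) ^ i / (Nat.factorial i : ℝ))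

/-- The normalized Laguerre polynomial `R_n^α(x) = L_n^α(x) / L_n^α(0)`. -/
def laguerreR (α : ℝ) (n : ℕ) (x : ℝ) : ℝ :=
  laguerreL α n x / laguerreL α n 0

/-- The measure `x^γ dx` on the half line `(0, ∞)`. -/
def powerMeasure (γ : ℝ) : Measure ℝ :=
  (volume.restrict (Ioi (0 : ℝ))).withDensity (fun x => ENNReal.ofReal (x ^ γ))

/-- Membership in the weighted space `L^p_{w(γ)}`: the function `x ↦ f(x) e^{-x/2}` is
in `L^p((0,∞), x^γ dx)`. The weight `x^γ` is positive on `(0,∞)`, so `x^γ dx` has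
the null sets of Lebesgue measure there. -/
def MemLw {𝕜 : Type*} [RCLike 𝕜] (p : ℝ≥0∞) (γ : ℝ) (f : ℝ → 𝕜) : Prop :=
  MemLp (fun x => Real.exp (-x / 2) • f x) p (powerMeasure γ)

/-- The norm of `L^p_{w(γ)}`: `(∫_0^∞ |f(x) e^{-x/2}|^p x^γ dx)^{1/p}` for `p < ∞`, and
`ess sup_{x>0} |f(x) e^{-x/2}|` for `p = ∞`. -/
def normLw {𝕜 : Type*} [RCLike 𝕜] (p : ℝ≥0∞) (γ : ℝ) (f : ℝ → 𝕜) : ℝ≥0∞ :=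
  eLpNorm (fun x => Real.exp (-x / 2) • f x) p (powerMeasure γ)

/-- The integrand `f(x) R_n^α(x) x^α e^{-x}` of the `n`-th coefficient. -/
def laguerreIntegrand {𝕜 : Type*} [RCLike 𝕜] (α : ℝ) (f : ℝ → 𝕜) (n : ℕ) (x : ℝ) : 𝕜 :=
  (laguerreR α n x * x ^ α * Real.exp (-x)) • f x

/-- The Fourier Laguerre coefficient `∫_0^∞ f(x) R_n^α(x) x^α e^{-x} dx` of order `α`. -/
def laguerreCoeff {𝕜 : Type*} [RCLike 𝕜] (α : ℝ) (f : ℝ → 𝕜) (n : ℕ) : 𝕜 :=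
  ∫ x in Ioi (0 : ℝ), laguerreIntegrand α f n x

/-- `f(x) ∼ Γ(α+1)⁻¹ ∑_k c_k L_k^α(x)`: all the coefficient integrals of `f` of order `α`
converge absolutely, and their values are the `c_k`. -/
def HasLaguerreSeries {𝕜 : Type*} [RCLike 𝕜] (α : ℝ) (f : ℝ → 𝕜) (c : ℕ → 𝕜) : Prop :=
  ∀ k : ℕ, IntegrableOn (laguerreIntegrand α f k) (Ioi (0 : ℝ)) ∧ laguerreCoeff α f k = c k

end

/-!
Write `μ = α - β > 0` and `F(x) = e^{-x/2} f(x)`. Termwise, the Beta integral gives the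
Riemann–Liouville formula
`∫_0^x (x-y)^{μ-1} y^β R_n^β(y) dy = B(β+1, μ) x^α R_n^α(x)`,
whose constant does not depend on `n` (`integral_truncPow_mul_laguerreR`). Inserting it in the
coefficient of order `α` of `f` and exchanging the integrals shows that
`g(y) = B(β+1, μ)⁻¹ ∫_y^∞ (x-y)^{μ-1} e^{-(x-y)} f(x) dx`
has the same coefficients of order `β` (`integral_laguerreR_smul_weylConv`).

In terms of weighted functions, `e^{-y/2} g(y)` is `B(β+1, μ)⁻¹` times the integral of `F` against
the positive kernel `k(x-y)`, `k(t) = t_+^{μ-1} e^{-t/2}`. Its integral in `x` is at most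
`∫ k < ∞`, and its integral in `y` against `y^β dy` is at most `B(β+1, μ) x^α`, so the Schur test
bounds it from `L^p(x^α dx)` to `L^p(y^β dy)` for every `1 ≤ p ≤ ∞`
(`exists_eLpNorm_weylConv_le`). Absolute convergence of all the integrals follows from
`|R_n^γ(x)| ≤ A e^{x/4}` and the finiteness of `e^{-x/4} x^γ dx`.
-/

/-! ### Truncated powers and the Beta integral -/

/-- The truncated power `t_+^{μ-1}`, with value `0` at `t ≤ 0` for every exponent. -/
noncomputable def truncPow (μ t : ℝ) : ℝ :=
  (Ioi (0 : ℝ)).indicator (fun t => t ^ (μ - 1)) t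

lemma truncPow_nonneg (μ t : ℝ) : 0 ≤ truncPow μ t :=
  indicator_nonneg (fun _ ht => Real.rpow_nonneg (le_of_lt ht) _) t

lemma measurable_truncPow (μ : ℝ) : Measurable (truncPow μ) :=
  (Measurable.pow_const measurable_id _).indicator measurableSet_Ioi

lemma integral_rpow_mul_sub_rpow {s t x : ℝ} (hs : 0 < s) (ht : 0 < t) (hx : 0 < x) :
    ∫ y in (0 : ℝ)..x, y ^ (s - 1) * (x - y) ^ (t - 1)
      = ProbabilityTheory.beta s t * x ^ (s + t - 1) := by
  have h := Complex.betaIntegral_scaled (s : ℂ) (t : ℂ) hx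
  have hB : Complex.betaIntegral (s : ℂ) (t : ℂ) = ((ProbabilityTheory.beta s t : ℝ) : ℂ) := by
    rw [Complex.betaIntegral_eq_Gamma_mul_div _ _ (by simpa) (by simpa), ProbabilityTheory.beta,
      ← Complex.ofReal_add]
    simp only [Complex.Gamma_ofReal]
    push_cast
    rfl
  rw [hB] at h
  apply Complex.ofReal_injective
  rw [← intervalIntegral.integral_ofReal, Complex.ofReal_mul, Complex.ofReal_cpow hx.le, mul_comm]
  push_cast
  rw [← h]
  refine intervalIntegral.integral_congr fun y hy => ?_
  rw [uIcc_of_le hx.le] at hy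
  rw [Complex.ofReal_cpow hy.1, Complex.ofReal_cpow (sub_nonneg.2 hy.2)]
  push_cast
  rfl

lemma integral_rpow_mul_truncPow {s t x : ℝ} (hs : 0 < s) (ht : 0 < t) (hx : 0 < x) :
    ∫ y in Ioi (0 : ℝ), y ^ (s - 1) * truncPow t (x - y)
      = ProbabilityTheory.beta s t * x ^ (s + t - 1) := by
  have h : (fun y => y ^ (s - 1) * truncPow t (x - y))
      = (Iio x).indicator (fun y => y ^ (s - 1) * (x - y) ^ (t - 1)) := by
    ext y
    by_cases hy : y < x
    · simp [truncPow, hy]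
    · simp [truncPow, hy]
  rw [h, setIntegral_indicator measurableSet_Iio, Ioi_inter_Iio, ← integral_Ioc_eq_integral_Ioo,
    ← intervalIntegral.integral_of_le hx.le, integral_rpow_mul_sub_rpow hs ht hx]

lemma integrableOn_rpow_mul_truncPow {s t x : ℝ} (hs : 0 < s) (ht : 0 < t) (hx : 0 < x) :
    IntegrableOn (fun y => y ^ (s - 1) * truncPow t (x - y)) (Ioi (0 : ℝ)) := by
  -- A nonzero Bochner integral is the integral of an integrable function.
  by_contra hn
  have h := integral_rpow_mul_truncPow hs ht hx
  rw [integral_undef hn] at h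
  exact absurd h (mul_pos (ProbabilityTheory.beta_pos hs ht) (Real.rpow_pos_of_pos hx _)).ne

lemma lintegral_rpow_mul_truncPow {s t x : ℝ} (hs : 0 < s) (ht : 0 < t) (hx : 0 < x) :
    ∫⁻ y in Ioi (0 : ℝ), ENNReal.ofReal (y ^ (s - 1) * truncPow t (x - y))
      = ENNReal.ofReal (ProbabilityTheory.beta s t * x ^ (s + t - 1)) := by
  rw [← integral_rpow_mul_truncPow hs ht hx,
    ofReal_integral_eq_lintegral_ofReal (integrableOn_rpow_mul_truncPow hs ht hx)]
  filter_upwards [ae_restrict_mem measurableSet_Ioi] with y hy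
  exact mul_nonneg (Real.rpow_nonneg (le_of_lt hy) _) (truncPow_nonneg _ _)

/-! ### Laguerre polynomials and fractional integration -/

lemma laguerreL_zero {α : ℝ} (n : ℕ) :
    laguerreL α n 0 = Real.Gamma (n + α + 1) / (n.factorial * Real.Gamma (α + 1)) := by
  rw [laguerreL, Finset.sum_eq_single_of_mem 0 (by simp)]
  · simp
  · intro i _ hi
    simp [zero_pow hi]

lemma laguerreR_eq_sum {α : ℝ} (hα : -1 < α) (n : ℕ) (x : ℝ) :
    laguerreR α n x = ∑ i ∈ Finset.range (n + 1),
      (-1) ^ i * n.factorial / ((n - i).factorial * i.factorial) *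
        (Real.Gamma (α + 1) / Real.Gamma (α + 1 + i)) * x ^ i := by
  rw [laguerreR, laguerreL_zero, laguerreL, Finset.sum_div]
  refine Finset.sum_congr rfl fun i _ => ?_
  have hi : (0 : ℝ) ≤ i := i.cast_nonneg
  have hn : (0 : ℝ) ≤ n := n.cast_nonneg
  have h1 : Real.Gamma (α + 1) ≠ 0 := (Real.Gamma_pos_of_pos (by linarith)).ne'
  have h2 : Real.Gamma (α + 1 + i) ≠ 0 := (Real.Gamma_pos_of_pos (by linarith)).ne'
  have h3 : Real.Gamma (n + α + 1) ≠ 0 := (Real.Gamma_pos_of_pos (by linarith)).ne'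
  rw [add_right_comm α i 1, neg_pow x]
  field_simp

/-- The rate `1/4` leaves a spare factor `e^{-x/4}` when the polynomial is paired with `e^{-x/2}`. -/
lemma exists_abs_laguerreR_le {α : ℝ} (hα : -1 < α) (n : ℕ) :
    ∃ A : ℝ, 0 ≤ A ∧ ∀ x : ℝ, 0 < x → |laguerreR α n x| ≤ A * Real.exp (x / 4) := by
  -- Termwise, `x^i ≤ i! 4^i e^{x/4}`.
  refine ⟨∑ i ∈ Finset.range (n + 1), |(-1) ^ i * n.factorial / ((n - i).factorial * i.factorial) *
        (Real.Gamma (α + 1) / Real.Gamma (α + 1 + i))| * (i.factorial * 4 ^ i),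
    Finset.sum_nonneg fun i _ => by positivity, fun x hx => ?_⟩
  rw [laguerreR_eq_sum hα, Finset.sum_mul]
  refine (Finset.abs_sum_le_sum_abs _ _).trans (Finset.sum_le_sum fun i _ => ?_)
  rw [abs_mul, mul_assoc _ _ (Real.exp _), abs_of_pos (pow_pos hx i)]
  gcongr
  have h := Real.pow_div_factorial_le_exp (x / 4) (by positivity) i
  rw [div_pow, div_div, div_le_iff₀ (by positivity)] at h
  linarith

lemma measurable_laguerreR (α : ℝ) (n : ℕ) : Measurable (laguerreR α n) := by
  unfold laguerreR laguerreL
  fun_prop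

/-- The Riemann–Liouville fractional integral of order `α - β` carries `y^β R_n^β` to a multiple,
independent of `n`, of `x^α R_n^α`. -/
lemma integral_truncPow_mul_laguerreR {α β : ℝ} (hβ : -1 < β) (hβα : β < α) (n : ℕ)
    {x : ℝ} (hx : 0 < x) :
    ∫ y in Ioi (0 : ℝ), truncPow (α - β) (x - y) * (y ^ β * laguerreR β n y)
      = ProbabilityTheory.beta (β + 1) (α - β) * (x ^ α * laguerreR α n x) := by
  have hα : -1 < α := hβ.trans hβα
  set a : ℝ → ℕ → ℝ := fun γ i => (-1) ^ i * n.factorial / ((n - i).factorial * i.factorial) *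
        (Real.Gamma (γ + 1) / Real.Gamma (γ + 1 + i)) with ha
  have hsum : ∀ y ∈ Ioi (0 : ℝ), truncPow (α - β) (x - y) * (y ^ β * laguerreR β n y)
      = ∑ i ∈ Finset.range (n + 1),
          a β i * (y ^ ((β + 1 + i) - 1) * truncPow (α - β) (x - y)) := by
    intro y hy
    rw [laguerreR_eq_sum hβ, Finset.mul_sum, Finset.mul_sum]
    refine Finset.sum_congr rfl fun i _ => ?_
    rw [show β + 1 + i - 1 = β + i by ring, Real.rpow_add hy, Real.rpow_natCast]
    ring
  have hpos : ∀ i : ℕ, 0 < β + 1 + i := fun i => by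
    have : (0 : ℝ) ≤ i := i.cast_nonneg
    linarith
  have hμ : 0 < α - β := sub_pos.2 hβα
  rw [setIntegral_congr_fun measurableSet_Ioi hsum, integral_finsetSum _ fun i _ =>
    (integrableOn_rpow_mul_truncPow (hpos i) hμ hx).const_mul _, laguerreR_eq_sum hα,
    Finset.mul_sum, Finset.mul_sum]
  refine Finset.sum_congr rfl fun i _ => ?_
  rw [integral_const_mul, integral_rpow_mul_truncPow (hpos i) hμ hx,
    show β + 1 + i + (α - β) - 1 = α + i by ring, Real.rpow_add hx, Real.rpow_natCast, ha]
  have h1 : Real.Gamma (β + 1 + i) ≠ 0 := (Real.Gamma_pos_of_pos (hpos i)).ne'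
  have h2 : Real.Gamma (α + 1) ≠ 0 := (Real.Gamma_pos_of_pos (by linarith)).ne'
  simp only [ProbabilityTheory.beta, show β + 1 + i + (α - β) = α + 1 + i by ring,
    show β + 1 + (α - β) = α + 1 by ring]
  field_simp

/-! ### A two-weight Schur test -/

/-- Jensen's inequality for an unnormalized weight `k`. -/
lemma lintegral_mul_rpow_le {X : Type*} [MeasurableSpace X] {μ : Measure X} {k φ : X → ℝ≥0∞}
    (hk : Measurable k) (hφ : AEMeasurable φ μ) {p : ℝ} (hp : 1 ≤ p) :
    (∫⁻ x, k x * φ x ∂μ) ^ p ≤ (∫⁻ x, k x ∂μ) ^ (p - 1) * ∫⁻ x, k x * φ x ^ p ∂μ := by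
  have hp0 : 0 < p := by linarith
  rcases hp.eq_or_lt with rfl | hp1
  · simp
  -- Hölder's inequality for the factorization `k φ = k^{1-1/p} (k^{1/p} φ)`.
  have h := ENNReal.lintegral_mul_le_Lp_mul_Lq μ (Real.HolderConjugate.conjExponent hp1).symm
    (hk.pow_const (1 - 1 / p)).aemeasurable ((hk.pow_const (1 / p)).aemeasurable.mul hφ)
  have e1 : ∀ x, k x ^ (1 - 1 / p) * (k x ^ (1 / p) * φ x) = k x * φ x := fun x => by
    rw [← mul_assoc, ← ENNReal.rpow_add_of_nonneg _ _ _ (by positivity)]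
    · simp
    · rw [sub_nonneg, div_le_one hp0]; exact hp
  have hq : (1 - 1 / p) * p.conjExponent = 1 := by
    rw [Real.conjExponent]
    have : p - 1 ≠ 0 := by linarith
    field_simp
  have e2 : ∀ x, (k x ^ (1 - 1 / p)) ^ p.conjExponent = k x := fun x => by
    rw [← ENNReal.rpow_mul, hq, ENNReal.rpow_one]
  have e3 : ∀ x, (k x ^ (1 / p) * φ x) ^ p = k x * φ x ^ p := fun x => by
    rw [ENNReal.mul_rpow_of_nonneg _ _ hp0.le, ← ENNReal.rpow_mul, one_div_mul_cancel hp0.ne',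
      ENNReal.rpow_one]
  simp only [Pi.mul_apply, e1, e2, e3] at h
  refine (ENNReal.rpow_le_rpow h hp0.le).trans_eq ?_
  rw [ENNReal.mul_rpow_of_nonneg _ _ hp0.le, ← ENNReal.rpow_mul, ← ENNReal.rpow_mul,
    one_div_mul_cancel hp0.ne', ENNReal.rpow_one]
  congr 2
  rw [Real.conjExponent]
  have : p - 1 ≠ 0 := by linarith
  field_simp

/-- Two-weight Schur test: bounds for the row and column integrals of a positive kernel (the
endpoints `p = ∞` and `p = 1`) give all the intermediate exponents. -/
lemma lintegral_rpow_kernel_le {X Y : Type*} [MeasurableSpace X] [MeasurableSpace Y]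
    {μ : Measure X} {ν : Measure Y} [SFinite μ] [SFinite ν] {k : Y → X → ℝ≥0∞}
    (hk : Measurable (Function.uncurry k)) {φ w : X → ℝ≥0∞} (hφ : AEMeasurable φ μ)
    (hw : Measurable w) {M N : ℝ≥0∞} (hM : ∀ y, ∫⁻ x, k y x ∂μ ≤ M)
    (hN : ∀ᵐ x ∂μ, ∫⁻ y, k y x ∂ν ≤ N * w x) {p : ℝ} (hp : 1 ≤ p) :
    ∫⁻ y, (∫⁻ x, k y x * φ x ∂μ) ^ p ∂ν ≤ M ^ (p - 1) * N * ∫⁻ x, w x * φ x ^ p ∂μ := by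
  have hφp : AEMeasurable (fun x => φ x ^ p) μ := hφ.pow_const p
  have hkφ : AEMeasurable (Function.uncurry fun y x => k y x * φ x ^ p) (ν.prod μ) :=
    hk.aemeasurable.mul hφp.comp_snd
  calc ∫⁻ y, (∫⁻ x, k y x * φ x ∂μ) ^ p ∂ν
      ≤ ∫⁻ y, M ^ (p - 1) * ∫⁻ x, k y x * φ x ^ p ∂μ ∂ν := by
        refine lintegral_mono fun y => ?_
        refine (lintegral_mul_rpow_le (hk.comp measurable_prodMk_left) hφ hp).trans ?_
        exact mul_le_mul_left (ENNReal.rpow_le_rpow (hM y) (by linarith)) _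
    _ = M ^ (p - 1) * ∫⁻ y, ∫⁻ x, k y x * φ x ^ p ∂μ ∂ν :=
        lintegral_const_mul'' _ hkφ.lintegral_prod_right'
    _ = M ^ (p - 1) * ∫⁻ x, ∫⁻ y, k y x * φ x ^ p ∂ν ∂μ := by rw [lintegral_lintegral_swap hkφ]
    _ ≤ M ^ (p - 1) * ∫⁻ x, N * (w x * φ x ^ p) ∂μ := by
        refine mul_le_mul_right (lintegral_mono_ae ?_) _
        filter_upwards [hN] with x hx
        have hkx : Measurable fun y => k y x := hk.comp measurable_prodMk_right
        rw [lintegral_mul_const _ hkx, ← mul_assoc]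
        exact mul_le_mul_left hx _
    _ = _ := by
        have hwφ : AEMeasurable (fun x => w x * φ x ^ p) μ := hw.aemeasurable.mul hφp
        rw [lintegral_const_mul'' _ hwφ, mul_assoc]

/-! ### The measure `x^γ dx` -/

lemma measurable_ofReal_rpow (γ : ℝ) : Measurable fun x : ℝ => ENNReal.ofReal (x ^ γ) :=
  (measurable_id.pow_const γ).ennreal_ofReal

lemma powerMeasure_absolutelyContinuous (γ : ℝ) :
    powerMeasure γ ≪ volume.restrict (Ioi (0 : ℝ)) :=
  withDensity_absolutelyContinuous _ _

lemma restrict_absolutelyContinuous_powerMeasure (γ : ℝ) :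
    volume.restrict (Ioi (0 : ℝ)) ≪ powerMeasure γ := by
  refine withDensity_absolutelyContinuous' (measurable_ofReal_rpow γ).aemeasurable ?_
  filter_upwards [ae_restrict_mem measurableSet_Ioi] with x hx
  exact (ENNReal.ofReal_pos.2 (Real.rpow_pos_of_pos hx _)).ne'

lemma lintegral_powerMeasure (γ : ℝ) (φ : ℝ → ℝ≥0∞) :
    ∫⁻ x, φ x ∂powerMeasure γ = ∫⁻ x in Ioi (0 : ℝ), ENNReal.ofReal (x ^ γ) * φ x := by
  rw [powerMeasure, lintegral_withDensity_eq_lintegral_mul_non_measurable₀ _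
    (measurable_ofReal_rpow γ).aemeasurable (by simp)]
  rfl

lemma integrableOn_rpow_mul_exp {s b : ℝ} (hs : -1 < s) (hb : 0 < b) :
    IntegrableOn (fun x : ℝ => x ^ s * Real.exp (-b * x)) (Ioi 0) := by
  simpa using integrableOn_rpow_mul_exp_neg_mul_rpow hs one_pos hb

/-- The measure `e^{-x/4} x^γ dx` is finite and at most `x^γ dx`, so it makes every function of
`L^p(x^γ dx)` integrable, for all `p ≥ 1` at once. -/
lemma integrableOn_exp_smul_of_memLp {E : Type*} [NormedAddCommGroup E] [NormedSpace ℝ E]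
    {p : ℝ≥0∞} (hp : 1 ≤ p) {γ : ℝ} (hγ : -1 < γ) {F : ℝ → E} (hF : MemLp F p (powerMeasure γ)) :
    IntegrableOn (fun x => (x ^ γ * Real.exp (-x / 4)) • F x) (Ioi 0) := by
  have hm : Measurable fun x : ℝ => ENNReal.ofReal (x ^ γ * Real.exp (-x / 4)) := by fun_prop
  have hle : (volume.restrict (Ioi (0 : ℝ))).withDensity
      (fun x => ENNReal.ofReal (x ^ γ * Real.exp (-x / 4))) ≤ powerMeasure γ := by
    refine withDensity_mono ?_
    filter_upwards [ae_restrict_mem measurableSet_Ioi] with x hx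
    refine ENNReal.ofReal_le_ofReal (mul_le_of_le_one_right (Real.rpow_nonneg (le_of_lt hx) _) ?_)
    rw [Real.exp_le_one_iff]
    have : (0 : ℝ) < x := hx
    linarith
  have hfin : IsFiniteMeasure ((volume.restrict (Ioi (0 : ℝ))).withDensity
      (fun x => ENNReal.ofReal (x ^ γ * Real.exp (-x / 4)))) := by
    refine isFiniteMeasure_withDensity_ofReal ?_
    have h := integrableOn_rpow_mul_exp hγ (b := 1 / 4) (by norm_num)
    refine (h.congr_fun (fun x _ => ?_) measurableSet_Ioi).2
    congr 2
    ring
  have h1 : Integrable F ((volume.restrict (Ioi (0 : ℝ))).withDensity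
      (fun x => ENNReal.ofReal (x ^ γ * Real.exp (-x / 4)))) :=
    memLp_one_iff_integrable.1 ((hF.mono_measure hle).mono_exponent hp)
  rw [integrable_withDensity_iff_integrable_smul' hm (by simp)] at h1
  refine IntegrableOn.congr_fun h1 (fun x hx => ?_) measurableSet_Ioi
  rw [ENNReal.toReal_ofReal]
  exact mul_nonneg (Real.rpow_nonneg (le_of_lt hx) _) (Real.exp_pos _).le

/-! ### The fractional integral operator -/

/-- The convolution kernel `t_+^{μ-1} e^{-t/2}`. -/
noncomputable def expKernel (μ t : ℝ) : ℝ :=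
  truncPow μ t * Real.exp (-t / 2)

lemma expKernel_nonneg (μ t : ℝ) : 0 ≤ expKernel μ t :=
  mul_nonneg (truncPow_nonneg _ _) (Real.exp_pos _).le

lemma measurable_expKernel (μ : ℝ) : Measurable (expKernel μ) :=
  (measurable_truncPow μ).mul (by fun_prop)

lemma expKernel_le_truncPow (μ t : ℝ) : expKernel μ t ≤ truncPow μ t := by
  by_cases ht : 0 < t
  · refine mul_le_of_le_one_right (truncPow_nonneg _ _) ?_
    rw [Real.exp_le_one_iff]
    linarith
  · simp [expKernel, truncPow, ht]

/-- Absorbing part of the decay of the kernel: if `y < x` then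
`e^{-(x-y)/2} e^{-y/4} ≤ e^{-x/4}`. -/
lemma expKernel_sub_mul_exp_le (μ x y : ℝ) :
    expKernel μ (x - y) * Real.exp (-y / 4) ≤ truncPow μ (x - y) * Real.exp (-x / 4) := by
  by_cases h : y < x
  · rw [expKernel, mul_assoc, ← Real.exp_add]
    refine mul_le_mul_of_nonneg_left (Real.exp_le_exp.2 ?_) (truncPow_nonneg _ _)
    linarith
  · simp [expKernel, truncPow, h]

lemma lintegral_expKernel_lt_top {μ : ℝ} (hμ : 0 < μ) :
    ∫⁻ t, ENNReal.ofReal (expKernel μ t) < ∞ := by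
  have h := integrableOn_rpow_mul_exp (s := μ - 1) (b := 1 / 2) (by linarith) (by norm_num)
  rw [← integrable_indicator_iff measurableSet_Ioi] at h
  refine lt_of_le_of_lt (lintegral_mono fun t => ?_) h.lintegral_lt_top
  refine ENNReal.ofReal_le_ofReal (le_of_eq ?_)
  by_cases ht : 0 < t
  · simp only [expKernel, truncPow, indicator_of_mem (mem_Ioi.2 ht)]
    congr 2
    ring
  · simp [expKernel, truncPow, ht]

lemma lintegral_expKernel_sub_le (μ y : ℝ) :
    ∫⁻ x in Ioi (0 : ℝ), ENNReal.ofReal (expKernel μ (x - y))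
      ≤ ∫⁻ t, ENNReal.ofReal (expKernel μ t) :=
  (setLIntegral_le_lintegral _ _).trans_eq
    (lintegral_sub_right_eq_self (fun t => ENNReal.ofReal (expKernel μ t)) y)

lemma lintegral_expKernel_sub_powerMeasure_le {α β : ℝ} (hβ : -1 < β) (hβα : β < α) {x : ℝ}
    (hx : 0 < x) :
    ∫⁻ y, ENNReal.ofReal (expKernel (α - β) (x - y)) ∂powerMeasure β
      ≤ ENNReal.ofReal (ProbabilityTheory.beta (β + 1) (α - β)) * ENNReal.ofReal (x ^ α) := by
  have hμ : 0 < α - β := sub_pos.2 hβα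
  have hB := ProbabilityTheory.beta_pos (show 0 < β + 1 by linarith) hμ
  have h := lintegral_rpow_mul_truncPow (show 0 < β + 1 by linarith) hμ hx
  rw [show β + 1 + (α - β) - 1 = α by ring, ENNReal.ofReal_mul hB.le] at h
  rw [← h, lintegral_powerMeasure]
  refine setLIntegral_mono' measurableSet_Ioi fun y hy => ?_
  rw [← ENNReal.ofReal_mul (Real.rpow_nonneg (le_of_lt hy) _), add_sub_cancel_right]
  exact ENNReal.ofReal_le_ofReal (mul_le_mul_of_nonneg_left (expKernel_le_truncPow _ _)
    (Real.rpow_nonneg (le_of_lt hy) _))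

section Transplant

variable {E : Type*} [NormedAddCommGroup E] [NormedSpace ℝ E]

/-- The truncated convolution `y ↦ ∫_{x > max(y, 0)} (x-y)^{μ-1} e^{-(x-y)/2} F(x) dx`: a Weyl
fractional integral of order `μ`, up to a constant and conjugation by `e^{x/2}`. -/
noncomputable def weylConv (μ : ℝ) (F : ℝ → E) (y : ℝ) : E :=
  ∫ x in Ioi (0 : ℝ), expKernel μ (x - y) • F x

lemma enorm_weylConv_le (μ : ℝ) (F : ℝ → E) (y : ℝ) :
    ‖weylConv μ F y‖ₑ ≤ ∫⁻ x in Ioi (0 : ℝ), ENNReal.ofReal (expKernel μ (x - y)) * ‖F x‖ₑ := by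
  refine (enorm_integral_le_lintegral_enorm _).trans_eq (lintegral_congr fun x => ?_)
  rw [enorm_smul, Real.enorm_of_nonneg (expKernel_nonneg _ _)]

lemma measurable_expKernel_sub (μ : ℝ) :
    Measurable (Function.uncurry fun y x : ℝ => expKernel μ (x - y)) :=
  (measurable_expKernel μ).comp (measurable_snd.sub measurable_fst)

lemma aestronglyMeasurable_weylConv (μ : ℝ) {F : ℝ → E}
    (hF : AEStronglyMeasurable F (volume.restrict (Ioi (0 : ℝ)))) :
    AEStronglyMeasurable (weylConv μ F) (volume.restrict (Ioi (0 : ℝ))) :=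
  ((measurable_expKernel_sub μ).aestronglyMeasurable.smul hF.comp_snd).integral_prod_right'

/-- `weylConv (α - β)` is bounded from `L^p(x^α dx)` to `L^p(y^β dy)` for `1 ≤ p ≤ ∞`. -/
lemma exists_eLpNorm_weylConv_le {p : ℝ≥0∞} (hp : 1 ≤ p) {α β : ℝ} (hβ : -1 < β) (hβα : β < α) :
    ∃ C : ℝ≥0, ∀ F : ℝ → E, AEStronglyMeasurable F (volume.restrict (Ioi (0 : ℝ))) →
      eLpNorm (weylConv (α - β) F) p (powerMeasure β) ≤ C * eLpNorm F p (powerMeasure α) := by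
  have hMtop := lintegral_expKernel_lt_top (sub_pos.2 hβα)
  set M := ∫⁻ t, ENNReal.ofReal (expKernel (α - β) t) with hM
  rcases eq_or_ne p ∞ with rfl | hptop
  · refine ⟨M.toNNReal, fun F _ => ?_⟩
    rw [ENNReal.coe_toNNReal hMtop.ne, eLpNorm_exponent_top, eLpNorm_exponent_top]
    refine eLpNormEssSup_le_of_ae_enorm_bound (Filter.Eventually.of_forall fun y => ?_)
    have hle : ∀ᵐ x ∂volume.restrict (Ioi (0 : ℝ)), ‖F x‖ₑ ≤ eLpNormEssSup F (powerMeasure α) :=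
      (restrict_absolutelyContinuous_powerMeasure α).ae_le (enorm_ae_le_eLpNormEssSup _ _)
    calc ‖weylConv (α - β) F y‖ₑ
        ≤ ∫⁻ x in Ioi (0 : ℝ), ENNReal.ofReal (expKernel (α - β) (x - y)) * ‖F x‖ₑ :=
          enorm_weylConv_le _ _ _
      _ ≤ ∫⁻ x in Ioi (0 : ℝ), ENNReal.ofReal (expKernel (α - β) (x - y)) *
            eLpNormEssSup F (powerMeasure α) := by
          refine lintegral_mono_ae ?_
          filter_upwards [hle] with x hx
          exact mul_le_mul_right hx _
      _ = (∫⁻ x in Ioi (0 : ℝ), ENNReal.ofReal (expKernel (α - β) (x - y))) *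
            eLpNormEssSup F (powerMeasure α) :=
          lintegral_mul_const _
            ((measurable_expKernel_sub (α - β)).comp measurable_prodMk_left).ennreal_ofReal
      _ ≤ M * eLpNormEssSup F (powerMeasure α) :=
          mul_le_mul_left (lintegral_expKernel_sub_le _ _) _
  · have hp0 : p ≠ 0 := (zero_lt_one.trans_le hp).ne'
    have hp1 : 1 ≤ p.toReal := by
      simpa using ENNReal.toReal_mono hptop hp
    set D := M ^ (p.toReal - 1) * ENNReal.ofReal (ProbabilityTheory.beta (β + 1) (α - β)) with hD
    have hDtop : D ^ (1 / p.toReal) ≠ ∞ := by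
      refine ENNReal.rpow_ne_top_of_nonneg (by positivity) (ENNReal.mul_ne_top ?_ (by simp))
      exact ENNReal.rpow_ne_top_of_nonneg (by linarith) hMtop.ne
    refine ⟨(D ^ (1 / p.toReal)).toNNReal, fun F hF => ?_⟩
    rw [ENNReal.coe_toNNReal hDtop, eLpNorm_eq_lintegral_rpow_enorm_toReal hp0 hptop,
      eLpNorm_eq_lintegral_rpow_enorm_toReal hp0 hptop,
      ← ENNReal.mul_rpow_of_nonneg _ _ (by positivity)]
    refine ENNReal.rpow_le_rpow ?_ (by positivity)
    rw [lintegral_powerMeasure α]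
    have : SFinite (powerMeasure β) := by unfold powerMeasure; infer_instance
    refine (lintegral_mono fun y => ENNReal.rpow_le_rpow (enorm_weylConv_le _ _ _)
      (by positivity)).trans (lintegral_rpow_kernel_le (w := fun x => ENNReal.ofReal (x ^ α))
        (measurable_expKernel_sub (α - β)).ennreal_ofReal hF.enorm (measurable_ofReal_rpow α)
        (lintegral_expKernel_sub_le _) ?_ hp1)
    filter_upwards [ae_restrict_mem measurableSet_Ioi] with x hx
    exact lintegral_expKernel_sub_powerMeasure_le hβ hβα hx

end Transplant

/-! ### The transplantation identity -/

section Fubini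

variable {E : Type*} [NormedAddCommGroup E] [NormedSpace ℝ E] {α β : ℝ} {F : ℝ → E}

/-- Absolute convergence of the double integral behind the transplantation identity. -/
lemma integrable_expKernel_smul (hβ : -1 < β) (hβα : β < α)
    (hFm : AEStronglyMeasurable F (volume.restrict (Ioi (0 : ℝ))))
    (hF : IntegrableOn (fun x => (x ^ α * Real.exp (-x / 4)) • F x) (Ioi 0)) (n : ℕ) :
    Integrable (Function.uncurry fun y x : ℝ =>
      (expKernel (α - β) (x - y) * (y ^ β * laguerreR β n y * Real.exp (-y / 2))) • F x)
      ((volume.restrict (Ioi (0 : ℝ))).prod (volume.restrict (Ioi (0 : ℝ)))) := by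
  have hμ : 0 < α - β := sub_pos.2 hβα
  have hβ1 : 0 < β + 1 := by linarith
  obtain ⟨A, hA, hR⟩ := exists_abs_laguerreR_le hβ n
  have hRm := measurable_laguerreR β n
  have hmeas : AEStronglyMeasurable (Function.uncurry fun y x : ℝ =>
      (expKernel (α - β) (x - y) * (y ^ β * laguerreR β n y * Real.exp (-y / 2))) • F x)
      ((volume.restrict (Ioi (0 : ℝ))).prod (volume.restrict (Ioi (0 : ℝ)))) := by
    refine AEStronglyMeasurable.smul (Measurable.aestronglyMeasurable ?_) hFm.comp_snd
    exact (measurable_expKernel_sub _).mul (by fun_prop)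
  refine ⟨hmeas, ?_⟩
  rw [hasFiniteIntegral_iff_enorm, lintegral_prod_symm _ hmeas.enorm]
  set B := ProbabilityTheory.beta (β + 1) (α - β) with hB
  have hB0 : 0 ≤ B := (ProbabilityTheory.beta_pos hβ1 hμ).le
  have hpt : ∀ x ∈ Ioi (0 : ℝ), ∀ y ∈ Ioi (0 : ℝ),
      ‖(expKernel (α - β) (x - y) * (y ^ β * laguerreR β n y * Real.exp (-y / 2))) • F x‖ₑ
        ≤ ENNReal.ofReal (A * Real.exp (-x / 4)) * ‖F x‖ₑ *
          ENNReal.ofReal (y ^ β * truncPow (α - β) (x - y)) := by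
    intro x hx y hy
    have hyβ : 0 ≤ y ^ β := Real.rpow_nonneg (le_of_lt hy) _
    rw [enorm_smul, mul_right_comm (ENNReal.ofReal _), ← ENNReal.ofReal_mul (by positivity),
      Real.enorm_eq_ofReal_abs]
    refine mul_le_mul_left (ENNReal.ofReal_le_ofReal ?_) _
    rw [abs_mul, abs_mul, abs_mul, abs_of_nonneg (expKernel_nonneg _ _), abs_of_nonneg hyβ,
      abs_of_pos (Real.exp_pos _)]
    calc expKernel (α - β) (x - y) * (y ^ β * |laguerreR β n y| * Real.exp (-y / 2))
        ≤ expKernel (α - β) (x - y) * (y ^ β * (A * Real.exp (y / 4)) * Real.exp (-y / 2)) := by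
          have := expKernel_nonneg (α - β) (x - y)
          have := hR y hy
          gcongr
      _ = A * y ^ β * (expKernel (α - β) (x - y) * Real.exp (-y / 4)) := by
          rw [show -y / 4 = y / 4 + -y / 2 by ring, Real.exp_add]
          ring
      _ ≤ A * y ^ β * (truncPow (α - β) (x - y) * Real.exp (-x / 4)) :=
          mul_le_mul_of_nonneg_left (expKernel_sub_mul_exp_le _ _ _) (by positivity)
      _ = _ := by ring
  have hint : ∀ x ∈ Ioi (0 : ℝ), ∫⁻ y in Ioi (0 : ℝ), ENNReal.ofReal (A * Real.exp (-x / 4)) *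
      ‖F x‖ₑ * ENNReal.ofReal (y ^ β * truncPow (α - β) (x - y))
        = ENNReal.ofReal (A * B) * ‖(x ^ α * Real.exp (-x / 4)) • F x‖ₑ := by
    intro x hx
    have hxα : 0 ≤ x ^ α := Real.rpow_nonneg (le_of_lt hx) _
    have h := lintegral_rpow_mul_truncPow hβ1 hμ hx
    rw [add_sub_cancel_right, show β + 1 + (α - β) - 1 = α by ring] at h
    have hm : Measurable fun y => ENNReal.ofReal (y ^ β * truncPow (α - β) (x - y)) :=
      ((measurable_id.pow_const β).mul
        ((measurable_truncPow _).comp (measurable_const.sub measurable_id))).ennreal_ofReal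
    rw [lintegral_const_mul _ hm, h, enorm_smul, Real.enorm_of_nonneg (by positivity),
      mul_right_comm, ← mul_assoc, ← ENNReal.ofReal_mul (by positivity),
      ← ENNReal.ofReal_mul (by positivity)]
    congr 2
    ring
  calc _ ≤ ∫⁻ x in Ioi (0 : ℝ), ENNReal.ofReal (A * B) *
          ‖(x ^ α * Real.exp (-x / 4)) • F x‖ₑ := by
        refine setLIntegral_mono_ae' measurableSet_Ioi (Filter.Eventually.of_forall fun x hx => ?_)
        rw [← hint x hx]
        exact setLIntegral_mono' measurableSet_Ioi (hpt x hx)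
    _ = ENNReal.ofReal (A * B) * ∫⁻ x in Ioi (0 : ℝ), ‖(x ^ α * Real.exp (-x / 4)) • F x‖ₑ :=
        lintegral_const_mul' _ _ (by simp)
    _ < ∞ := ENNReal.mul_lt_top (by simp) hF.2

/-- The exponentials combine to `e^{-(x-y)/2} e^{-y/2} = e^{-x/2}`, leaving the Riemann–Liouville
integral of `y^β R_n^β`. -/
lemma integral_expKernel_smul_left [CompleteSpace E] (hβ : -1 < β) (hβα : β < α) (n : ℕ)
    {x : ℝ} (hx : 0 < x) (v : E) :
    ∫ y in Ioi (0 : ℝ),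
        (expKernel (α - β) (x - y) * (y ^ β * laguerreR β n y * Real.exp (-y / 2))) • v
      = ProbabilityTheory.beta (β + 1) (α - β) •
          (x ^ α * laguerreR α n x * Real.exp (-x / 2)) • v := by
  have h : ∀ y, expKernel (α - β) (x - y) * (y ^ β * laguerreR β n y * Real.exp (-y / 2))
      = truncPow (α - β) (x - y) * (y ^ β * laguerreR β n y) * Real.exp (-x / 2) := by
    intro y
    rw [expKernel, show -x / 2 = -(x - y) / 2 + -y / 2 by ring, Real.exp_add]
    ring
  simp_rw [h]
  rw [integral_smul_const, integral_mul_const, integral_truncPow_mul_laguerreR hβ hβα n hx,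
    smul_smul]
  congr 1
  ring

/-- The transplantation identity: pairing `weylConv (α - β) F` with the Laguerre polynomials of
order `β` is, up to the factor `B(β+1, α-β)`, pairing `F` with those of order `α`. -/
lemma integral_laguerreR_smul_weylConv [CompleteSpace E] (hβ : -1 < β) (hβα : β < α)
    (hFm : AEStronglyMeasurable F (volume.restrict (Ioi (0 : ℝ))))
    (hF : IntegrableOn (fun x => (x ^ α * Real.exp (-x / 4)) • F x) (Ioi 0)) (n : ℕ) :
    IntegrableOn (fun y => (y ^ β * laguerreR β n y * Real.exp (-y / 2)) • weylConv (α - β) F y)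
        (Ioi 0) ∧
      ∫ y in Ioi (0 : ℝ), (y ^ β * laguerreR β n y * Real.exp (-y / 2)) • weylConv (α - β) F y
        = ProbabilityTheory.beta (β + 1) (α - β) •
          ∫ x in Ioi (0 : ℝ), (x ^ α * laguerreR α n x * Real.exp (-x / 2)) • F x := by
  have hI := integrable_expKernel_smul hβ hβα hFm hF n
  have hy : ∀ y, ∫ x in Ioi (0 : ℝ),
      (expKernel (α - β) (x - y) * (y ^ β * laguerreR β n y * Real.exp (-y / 2))) • F x
        = (y ^ β * laguerreR β n y * Real.exp (-y / 2)) • weylConv (α - β) F y := by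
    intro y
    rw [weylConv, ← integral_smul]
    refine integral_congr_ae (Filter.Eventually.of_forall fun x => ?_)
    simp only [smul_smul, mul_comm (expKernel _ _)]
  constructor
  · have h := hI.integral_prod_left
    simp only [Function.uncurry_apply_pair, hy] at h
    exact h
  · have h := integral_integral_swap hI
    simp only [hy] at h
    rw [h, ← integral_smul]
    exact setIntegral_congr_fun measurableSet_Ioi fun x hx =>
      integral_expKernel_smul_left hβ hβα n hx (F x)

end Fubini

/-! ### Transplantation of Laguerre series -/

lemma integrableOn_laguerreIntegrand {𝕜 : Type*} [RCLike 𝕜] {p : ℝ≥0∞} (hp : 1 ≤ p) {α : ℝ}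
    (hα : -1 < α) {f : ℝ → 𝕜} (hf : MemLw p α f) (n : ℕ) :
    IntegrableOn (laguerreIntegrand α f n) (Ioi 0) := by
  obtain ⟨A, hA, hR⟩ := exists_abs_laguerreR_le hα n
  have h := integrableOn_exp_smul_of_memLp hp hα hf
  have hb : IntegrableOn (fun x : ℝ => (laguerreR α n x * Real.exp (-x / 4)) •
      ((x ^ α * Real.exp (-x / 4)) • Real.exp (-x / 2) • f x)) (Ioi 0) := by
    refine Integrable.bdd_smul (𝕜 := ℝ) h A ?_ ?_
    · exact ((measurable_laguerreR α n).mul (by fun_prop)).aestronglyMeasurable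
    · filter_upwards [ae_restrict_mem measurableSet_Ioi] with x hx
      rw [Real.norm_eq_abs, abs_mul, abs_of_pos (Real.exp_pos _)]
      calc _ ≤ A * Real.exp (x / 4) * Real.exp (-x / 4) :=
            mul_le_mul_of_nonneg_right (hR x hx) (Real.exp_pos _).le
        _ = A := by
            rw [mul_assoc, ← Real.exp_add, show x / 4 + -x / 4 = 0 by ring, Real.exp_zero, mul_one]
  refine hb.congr_fun (fun x _ => ?_) measurableSet_Ioi
  simp only [laguerreIntegrand, smul_smul]
  rw [show -x = -x / 4 + (-x / 4 + -x / 2) by ring, Real.exp_add, Real.exp_add]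
  ring_nf

theorem theorem2p1 {𝕜 : Type*} [RCLike 𝕜] (p : ℝ≥0∞) (hp : 1 ≤ p) (α β : ℝ)
    (hα : -1 < α) (hα_top : p = ∞ → 0 ≤ α) (hβ : -1 < β) (hβα : β < α) :
    ∃ C : ℝ≥0, ∀ f : ℝ → 𝕜, MemLw p α f →
      HasLaguerreSeries α f (laguerreCoeff α f) ∧
      ∃ g : ℝ → 𝕜, MemLw p β g ∧
        HasLaguerreSeries β g (laguerreCoeff α f) ∧
        normLw p β g ≤ (C : ℝ≥0∞) * normLw p α f := by
  obtain ⟨C, hC⟩ := exists_eLpNorm_weylConv_le (E := 𝕜) hp hβ hβα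
  set B := ProbabilityTheory.beta (β + 1) (α - β) with hB
  have hB0 : 0 < B := ProbabilityTheory.beta_pos (by linarith) (sub_pos.2 hβα)
  refine ⟨‖B⁻¹‖₊ * C, fun f hf => ⟨fun k => ⟨integrableOn_laguerreIntegrand hp hα hf k, rfl⟩, ?_⟩⟩
  set F : ℝ → 𝕜 := fun x => Real.exp (-x / 2) • f x with hFdef
  have hFm : AEStronglyMeasurable F (volume.restrict (Ioi (0 : ℝ))) :=
    hf.1.mono_ac (restrict_absolutelyContinuous_powerMeasure α)
  have hF1 : IntegrableOn (fun x => (x ^ α * Real.exp (-x / 4)) • F x) (Ioi 0) :=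
    integrableOn_exp_smul_of_memLp hp hα hf
  set W := weylConv (α - β) F with hW
  -- The factor `e^{y/2}` undoes the weight, so that `e^{-y/2} g` is a multiple of `W`.
  set g : ℝ → 𝕜 := fun y => Real.exp (y / 2) • B⁻¹ • W y with hg
  have hgW : (fun y => Real.exp (-y / 2) • g y) = B⁻¹ • W := by
    ext y
    rw [hg, smul_smul, ← Real.exp_add, show -y / 2 + y / 2 = 0 by ring, Real.exp_zero, one_smul]
    rfl
  have hnorm : normLw p β g ≤ ((‖B⁻¹‖₊ * C : ℝ≥0) : ℝ≥0∞) * normLw p α f := by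
    rw [normLw, hgW, eLpNorm_const_smul, ENNReal.coe_mul, mul_assoc]
    exact mul_le_mul_right (hC F hFm) _
  refine ⟨g, ⟨?_, hnorm.trans_lt (ENNReal.mul_lt_top ENNReal.coe_lt_top hf.2)⟩, fun k => ?_, hnorm⟩
  · rw [hgW]
    exact ((aestronglyMeasurable_weylConv _ hFm).mono_ac
      (powerMeasure_absolutelyContinuous β)).const_smul _
  · obtain ⟨h1, h2⟩ := integral_laguerreR_smul_weylConv hβ hβα hFm hF1 k
    have hgi : laguerreIntegrand β g k =
        fun y => B⁻¹ • ((y ^ β * laguerreR β k y * Real.exp (-y / 2)) • W y) := by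
      ext y
      have he : Real.exp (-y) * Real.exp (y / 2) = Real.exp (-y / 2) := by
        rw [← Real.exp_add]
        ring_nf
      simp only [laguerreIntegrand, hg, smul_smul]
      congr 1
      rw [← he]
      ring
    have hfi : laguerreIntegrand α f k =
        fun x => (x ^ α * laguerreR α k x * Real.exp (-x / 2)) • F x := by
      ext x
      rw [laguerreIntegrand, hFdef, smul_smul, mul_assoc _ (Real.exp _), ← Real.exp_add,
        show -x / 2 + -x / 2 = -x by ring, mul_comm (laguerreR α k x)]
    rw [laguerreCoeff, laguerreCoeff, hgi, hfi]
    refine ⟨h1.smul B⁻¹, ?_⟩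
    rw [integral_smul, h2, inv_smul_smul₀ hB0.ne']
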